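/- Let $A$ be a commutative Noetherian ring, $\mathfrak q\subseteq A$ an ideal, $G=\bigoplus_{n\ge 0}\mathfrak q^n/\mathfrak q^{n+1}$ the form ring, and $Q\subseteq G$ the homogeneous ideal generated by the initial forms of all elements of $\mathfrak q$. Let $x_1,\dots,x_m$ be a finite system of homogeneous generators of $Q$. Let $H^i(Q;G)=H^i(x_1,\dots,x_m;G)$ denote the Koszul cohomology, let $$H^i_Q(G)=\varinjlim_k H^i(x_1^k,\dots,x_m^k;G)$$ denote the local cohomology, with its natural $\mathbb Z$-grading, and let $f^i_G: H^i(Q;G)\to H^i_Q(G)$ be the canonical homomorphism from the term $k=1$ into the direct limit. For $n\in\mathbb Z$ let $[H^i_Q(G)]_n$ denote the homogeneous component of degree $n$. **Theorem 1.3.** Let $t$ be an integer. Assume that $Q\,H^i_Q(G)=0$ for all $i<t$. Assume moreover that for all integers $0\le i<j<t$ and all integers $p,q$ such that $$[H^i_Q(G)]_{p-i}\ne 0\quad\text{and}\quad [H^j_Q(G)]_{q-j}\ne 0$$ we have $p-q\ne 1$. Then the canonical homomorphism $f^i_G: H^i(Q;G)\to H^i_Q(G)$ is surjective for all $i<t$.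 -/

import Mathlib

noncomputable section

/-! ### The form ring of an ideal -/

/-- The graded piece `q ^ n / q ^ (n + 1)` of the form ring. -/
abbrev FormPiece {A : Type*} [CommRing A] (q : Ideal A) (n : ℕ) : Type _ :=
  ↥(q ^ n) ⧸ (Submodule.comap (Submodule.subtype (q ^ n)) (q ^ (n + 1)))

namespace FormPiece

variable {A : Type*} [CommRing A] {q : Ideal A}

/-- The class in `q ^ n / q ^ (n + 1)` of an element of `q ^ n`. -/
def cls (n : ℕ) : ↥(q ^ n) →ₗ[A] FormPiece q n :=
  Submodule.mkQ _

theorem cls_surjective (n : ℕ) : Function.Surjective (cls (q := q) n) :=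
  Submodule.mkQ_surjective _

theorem cls_eq_zero {n : ℕ} (a : ↥(q ^ n)) : cls n a = 0 ↔ (a : A) ∈ q ^ (n + 1) := by
  simp [cls]

/-- Multiplication by `a ∈ q ^ m` as a map `q ^ n / q ^ (n + 1) → q ^ (m + n) / q ^ (m + n + 1)`. -/
def mulLeft {m : ℕ} (n : ℕ) (a : ↥(q ^ m)) : FormPiece q n →ₗ[A] FormPiece q (m + n) :=
  Submodule.liftQ _
    (cls (m + n) ∘ₗ LinearMap.codRestrict (q ^ (m + n))
      (LinearMap.mulLeft A (a : A) ∘ₗ Submodule.subtype (q ^ n))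
      (fun b => by
        change (a : A) * (b : A) ∈ q ^ (m + n)
        rw [pow_add]; exact Ideal.mul_mem_mul a.2 b.2))
    (fun b hb => by
      have h := Ideal.mul_mem_mul a.2 (show (b : A) ∈ q ^ (n + 1) from hb)
      rw [← pow_add, ← add_assoc] at h
      exact (cls_eq_zero _).2 h)

theorem mulLeft_cls {m n : ℕ} (a : ↥(q ^ m)) (b : ↥(q ^ n)) :
    mulLeft n a (cls n b) =
      cls (m + n) ⟨(a : A) * b, by rw [pow_add]; exact Ideal.mul_mem_mul a.2 b.2⟩ :=
  rfl

/-- The product `q ^ m / q ^ (m + 1) × q ^ n / q ^ (n + 1) → q ^ (m + n) / q ^ (m + n + 1)`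
induced by the multiplication of the ring. -/
def mulHom (m n : ℕ) : FormPiece q m →ₗ[A] FormPiece q n →ₗ[A] FormPiece q (m + n) :=
  Submodule.liftQ _
    { toFun := fun a : ↥(q ^ m) => mulLeft n a
      map_add' := fun a a' => by
        refine LinearMap.ext fun y => ?_
        obtain ⟨b, rfl⟩ := cls_surjective n y
        rw [LinearMap.add_apply, mulLeft_cls, mulLeft_cls, mulLeft_cls, ← map_add]
        congr 1; ext; exact add_mul _ _ _
      map_smul' := fun c a => by
        refine LinearMap.ext fun y => ?_
        obtain ⟨b, rfl⟩ := cls_surjective n y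
        rw [RingHom.id_apply, LinearMap.smul_apply, mulLeft_cls, mulLeft_cls, ← map_smul]
        congr 1; ext; exact mul_assoc _ _ _ }
    (fun a ha => by
      refine LinearMap.ext fun y => ?_
      obtain ⟨b, rfl⟩ := cls_surjective n y
      have h := Ideal.mul_mem_mul (show (a : A) ∈ q ^ (m + 1) from ha) b.2
      rw [← pow_add, show m + 1 + n = m + n + 1 by ring] at h
      exact (cls_eq_zero _).2 h)

theorem mulHom_cls {m n : ℕ} (a : ↥(q ^ m)) (b : ↥(q ^ n)) :
    mulHom m n (cls m a) (cls n b) =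
      cls (m + n) ⟨(a : A) * b, by rw [pow_add]; exact Ideal.mul_mem_mul a.2 b.2⟩ :=
  rfl

theorem mk_cls_eq {i j : ℕ} (h : i = j) {a : ↥(q ^ i)} {b : ↥(q ^ j)} (hab : (a : A) = b) :
    GradedMonoid.mk (A := FormPiece q) i (cls i a) = GradedMonoid.mk j (cls j b) := by
  subst h
  rw [Subtype.ext hab]

instance : GradedMonoid.GOne (FormPiece q) where
  one := cls 0 ⟨1, by simp⟩

instance : GradedMonoid.GMul (FormPiece q) where
  mul x y := mulHom _ _ x y

instance : DirectSum.GCommRing (FormPiece q) where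
  mul_zero x := map_zero _
  zero_mul y := LinearMap.map_zero₂ _ y
  mul_add x y z := map_add _ _ _
  add_mul x y z := LinearMap.map_add₂ _ x y z
  one_mul := by
    rintro ⟨i, x⟩
    obtain ⟨a, rfl⟩ := cls_surjective i x
    exact mk_cls_eq (zero_add i) (one_mul (a : A))
  mul_one := by
    rintro ⟨i, x⟩
    obtain ⟨a, rfl⟩ := cls_surjective i x
    exact mk_cls_eq (add_zero i) (mul_one (a : A))
  mul_assoc := by
    rintro ⟨i, x⟩ ⟨j, y⟩ ⟨k, z⟩
    obtain ⟨a, rfl⟩ := cls_surjective i x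
    obtain ⟨b, rfl⟩ := cls_surjective j y
    obtain ⟨c, rfl⟩ := cls_surjective k z
    exact mk_cls_eq (add_assoc i j k) (mul_assoc (a : A) b c)
  mul_comm := by
    rintro ⟨i, x⟩ ⟨j, y⟩
    obtain ⟨a, rfl⟩ := cls_surjective i x
    obtain ⟨b, rfl⟩ := cls_surjective j y
    exact mk_cls_eq (add_comm i j) (mul_comm (a : A) b)
  natCast n := cls 0 ⟨(n : A), by simp⟩
  natCast_zero := by
    rw [cls_eq_zero]; simp
  natCast_succ n := by
    change _ = cls 0 _ + cls 0 _
    rw [← map_add]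
    congr 1; ext; simp
  intCast n := cls 0 ⟨(n : A), by simp⟩
  intCast_ofNat n := by
    congr 1; ext; simp
  intCast_negSucc_ofNat n := by
    rw [← map_neg]
    congr 1; ext; simp

end FormPiece

/-- The form ring `G_A(q) = ⨁ₙ q ^ n / q ^ (n + 1)`. -/
def FormRing {A : Type*} [CommRing A] (q : Ideal A) : Type _ :=
  DirectSum ℕ (FormPiece q)

namespace FormRing

variable {A : Type*} [CommRing A] (q : Ideal A)

instance : CommRing (FormRing q) :=
  inferInstanceAs (CommRing (DirectSum ℕ (FormPiece q)))

/-- The inclusion of the homogeneous component of degree `n`. -/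
def of (n : ℕ) : FormPiece q n →+ FormRing q :=
  DirectSum.of (FormPiece q) n

/-- The projection onto the homogeneous component of degree `n`. -/
def coeff (n : ℕ) : FormRing q →+ FormPiece q n :=
  DFinsupp.evalAddMonoidHom n

/-- The homogeneous elements of degree `k ∈ ℤ` of the form ring: those whose components in all
degrees other than `k` vanish. It is zero for `k < 0`. -/
def piece (k : ℤ) : AddSubgroup (FormRing q) where
  carrier := {g | ∀ n : ℕ, (n : ℤ) ≠ k → coeff q n g = 0}
  zero_mem' _ _ := map_zero _
  add_mem' {g h} hg hh n hn := by
    rw [map_add, hg n hn, hh n hn, add_zero]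
  neg_mem' {g} hg n hn := by
    rw [map_neg, hg n hn, neg_zero]

/-- `g` is the initial form of `a`: there is an `n` with `a ∈ q ^ n`, `a ∉ q ^ (n + 1)`, and `g`
is the class of `a` in `q ^ n / q ^ (n + 1)`. -/
def IsInitialForm (a : A) (g : FormRing q) : Prop :=
  ∃ (n : ℕ) (h : a ∈ q ^ n), a ∉ q ^ (n + 1) ∧
    g = of q n (FormPiece.cls n ⟨a, h⟩)

/-- The ideal `Q` of the form ring generated by the initial forms of the elements of `q`. -/
def initialIdeal : Ideal (FormRing q) :=
  Ideal.span {g | ∃ a ∈ q, IsInitialForm q a g}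

end FormRing

/-! ### Koszul cohomology -/

namespace Koszul

variable {R : Type*} [CommRing R] (M : Type*) [AddCommGroup M] [Module R M] {m : ℕ}

/-- The underlying module of the Koszul cochain complex on `m` elements with coefficients
in `M`: a cochain `c` stands for `∑ I, c I • e_I`, where `I` runs through the subsets of
`{0, …, m - 1}` and `e_I` is the wedge product of the `e_i` with `i ∈ I`, in increasing order. -/
abbrev Cochains (m : ℕ) (M : Type*) : Type _ :=
  Finset (Fin m) → M

/-- The Koszul differential `c ↦ (∑ j, x j • e_j) ∧ c`. -/
def d (x : Fin m → R) : Cochains m M →ₗ[R] Cochains m M where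
  toFun c J := ∑ j ∈ J, (-1 : R) ^ (J.filter (· < j)).card • x j • c (J.erase j)
  map_add' c c' := by
    ext J
    simp only [Pi.add_apply, smul_add, Finset.sum_add_distrib]
  map_smul' r c := by
    ext J
    simp only [Pi.smul_apply, RingHom.id_apply, Finset.smul_sum]
    refine Finset.sum_congr rfl fun j _ => ?_
    rw [smul_comm (x j) r, smul_comm _ r]

variable (R) in
/-- The Koszul cochains of degree `p ∈ ℤ`, supported on the `e_I` with `|I| = p`. -/
def degree (m : ℕ) (p : ℤ) : Submodule R (Cochains m M) where
  carrier := {c | ∀ I, (I.card : ℤ) ≠ p → c I = 0}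
  zero_mem' _ _ := rfl
  add_mem' {c c'} hc hc' I hI := by
    rw [Pi.add_apply, hc I hI, hc' I hI, add_zero]
  smul_mem' r c hc I hI := by
    rw [Pi.smul_apply, hc I hI, smul_zero]

/-- The Koszul cocycles of degree `p`. -/
def cocycles (x : Fin m → R) (p : ℤ) : Submodule R (Cochains m M) :=
  degree R M m p ⊓ LinearMap.ker (d M x)

/-- The Koszul coboundaries of degree `p`. -/
def coboundaries (x : Fin m → R) (p : ℤ) : Submodule R (Cochains m M) :=
  Submodule.map (d M x) (degree R M m (p - 1))

/-- The Koszul cohomology `H^p(x; M)`: cocycles modulo coboundaries. -/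
def Cohomology (x : Fin m → R) (p : ℤ) : Type _ :=
  ↥(cocycles M x p) ⧸ Submodule.comap (Submodule.subtype (cocycles M x p)) (coboundaries M x p)

instance (x : Fin m → R) (p : ℤ) : AddCommGroup (Cohomology M x p) :=
  inferInstanceAs (AddCommGroup (↥(cocycles M x p) ⧸
    Submodule.comap (Submodule.subtype (cocycles M x p)) (coboundaries M x p)))

instance (x : Fin m → R) (p : ℤ) : Module R (Cohomology M x p) :=
  inferInstanceAs (Module R (↥(cocycles M x p) ⧸
    Submodule.comap (Submodule.subtype (cocycles M x p)) (coboundaries M x p)))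

/-- The cohomology class of a Koszul cocycle. -/
def cls (x : Fin m → R) (p : ℤ) : ↥(cocycles M x p) →ₗ[R] Cohomology M x p :=
  Submodule.mkQ _

/-- The map `e_I ↦ (∏ i ∈ I, a i) e_I` of Koszul cochains. -/
def scale (a : Fin m → R) : Cochains m M →ₗ[R] Cochains m M where
  toFun c I := (∏ i ∈ I, a i) • c I
  map_add' c c' := by
    ext I
    simp only [Pi.add_apply, smul_add]
  map_smul' r c := by
    ext I
    simp only [Pi.smul_apply, RingHom.id_apply]
    rw [smul_comm]

variable {M}

theorem scale_mem_degree (a : Fin m → R) {p : ℤ} {c : Cochains m M}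
    (hc : c ∈ degree R M m p) : scale M a c ∈ degree R M m p := fun I hI => by
  change (∏ i ∈ I, a i) • c I = 0
  rw [hc I hI, smul_zero]

/-- Multiplication by `a` is a map of complexes from the Koszul complex of `x` to the Koszul
complex of `a * x`. -/
theorem d_scale (a x : Fin m → R) (c : Cochains m M) :
    d M (a * x) (scale M a c) = scale M a (d M x c) := by
  ext J
  simp only [d, scale, LinearMap.coe_mk, AddHom.coe_mk, Finset.smul_sum, Pi.mul_apply]
  refine Finset.sum_congr rfl fun j hj => ?_
  rw [← Finset.mul_prod_erase J a hj]
  simp only [smul_smul]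
  congr 1
  ring

theorem d_mem_degree (x : Fin m → R) {p : ℤ} {c : Cochains m M}
    (hc : c ∈ degree R M m (p - 1)) : d M x c ∈ degree R M m p := fun J hJ => by
  change ∑ j ∈ J, (-1 : R) ^ (J.filter (· < j)).card • x j • c (J.erase j) = 0
  refine Finset.sum_eq_zero fun j hj => ?_
  have h1 : ((J.erase j).card : ℤ) ≠ p - 1 := by
    have := Finset.card_erase_add_one hj
    omega
  rw [hc _ h1, smul_zero, smul_zero]

theorem card_filter_erase (J : Finset (Fin m)) (j k : Fin m) (hj : j ∈ J) :
    ((J.erase j).filter (· < k)).card + (if j < k then 1 else 0) = (J.filter (· < k)).card := by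
  rw [Finset.filter_erase]
  split_ifs with h
  · exact Finset.card_erase_add_one (Finset.mem_filter.2 ⟨hj, h⟩)
  · rw [Finset.erase_eq_of_notMem (by simp [h]), add_zero]

/-- The Koszul complex is a complex. -/
theorem d_d (x : Fin m → R) (c : Cochains m M) : d M x (d M x c) = 0 := by
  ext J
  simp only [d, LinearMap.coe_mk, AddHom.coe_mk, Pi.zero_apply, Finset.smul_sum, smul_smul]
  rw [Finset.sum_sigma']
  refine Finset.sum_involution (fun a _ => ⟨a.2, a.1⟩) ?_ ?_ ?_ ?_
  · rintro ⟨j, k⟩ h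
    simp only [Finset.mem_sigma, Finset.mem_erase] at h
    obtain ⟨hj, hkj, hk⟩ := h
    dsimp only
    rw [Finset.erase_right_comm (a := k), ← add_smul]
    have h1 := card_filter_erase J j k hj
    have h2 := card_filter_erase J k j hk
    have : ∀ r : M, (0:R) • r = 0 := zero_smul R
    convert this _
    rcases lt_or_gt_of_ne hkj with h | h
    · rw [if_neg (not_lt.2 h.le)] at h1
      rw [if_pos h] at h2
      rw [← h1, ← h2]; ring
    · rw [if_pos h] at h1
      rw [if_neg (not_lt.2 h.le)] at h2
      rw [← h1, ← h2]; ring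
  · rintro ⟨j, k⟩ h _ he
    simp only [Finset.mem_sigma, Finset.mem_erase] at h
    exact h.2.1 (congrArg Sigma.fst he)
  · rintro ⟨j, k⟩ h
    simp only [Finset.mem_sigma, Finset.mem_erase] at h ⊢
    exact ⟨h.2.2, h.2.1.symm, h.1⟩
  · rintro ⟨j, k⟩ h; rfl

variable (M)

/-- The map `H^p(x; M) → H^p(y; M)` of Koszul cohomology induced by
`e_I ↦ (∏ i ∈ I, a i) e_I`, where `y = a * x`. -/
def cohomologyMap (a : Fin m → R) {x y : Fin m → R} (h : a * x = y) (p : ℤ) :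
    Cohomology M x p →ₗ[R] Cohomology M y p :=
  Submodule.mapQ _ _
    (LinearMap.restrict (scale M a) (p := cocycles M x p) (q := cocycles M y p) (by
      rintro c ⟨hc, hdc⟩
      refine ⟨scale_mem_degree a hc, ?_⟩
      subst h
      change d M (a * x) (scale M a c) = 0
      rw [d_scale, show d M x c = 0 from hdc, map_zero]))
    (by
      rintro ⟨c, hc'⟩ ⟨b, hb, hbc⟩
      refine ⟨scale M a b, scale_mem_degree a hb, ?_⟩
      subst h
      rw [d_scale, hbc]
      rfl)

end Koszul

/-! ### Local cohomology -/

namespace LocalCohomology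

variable {R : Type*} [CommRing R] (M : Type*) [AddCommGroup M] [Module R M] {m : ℕ}

/-- The map `H^p(x ^ k; M) → H^p(x ^ l; M)`, `k ≤ l`, induced by
`e_I ↦ (∏ i ∈ I, x i) ^ (l - k) e_I`. -/
def transition (x : Fin m → R) (p : ℤ) (k l : ℕ) (h : k ≤ l) :
    Koszul.Cohomology M (x ^ k) p →ₗ[R] Koszul.Cohomology M (x ^ l) p :=
  Koszul.cohomologyMap M (x ^ (l - k)) (pow_sub_mul_pow x h) p

end LocalCohomology

/-- The local cohomology `H^p_I(M)` of an `R`-module `M` with respect to the ideal `I` generated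
by `x 0, …, x (m - 1)`, as the direct limit of the Koszul cohomology modules
`H^p(x 0 ^ k, …, x (m - 1) ^ k; M)` over `k`. -/
def LocalCohomology {R : Type*} [CommRing R] (M : Type*) [AddCommGroup M] [Module R M]
    {m : ℕ} (x : Fin m → R) (p : ℤ) : Type _ :=
  Module.DirectLimit (fun k : ℕ => Koszul.Cohomology M (x ^ k) p)
    (LocalCohomology.transition M x p)

namespace LocalCohomology

section

variable {R : Type*} [CommRing R] (M : Type*) [AddCommGroup M] [Module R M] {m : ℕ}

instance (x : Fin m → R) (p : ℤ) : AddCommGroup (LocalCohomology M x p) :=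
  Module.DirectLimit.addCommGroup (fun k : ℕ => Koszul.Cohomology M (x ^ k) p)
    (transition M x p)

instance (x : Fin m → R) (p : ℤ) : Module R (LocalCohomology M x p) :=
  Module.DirectLimit.module (fun k : ℕ => Koszul.Cohomology M (x ^ k) p)
    (transition M x p)

/-- The map `H^p(x ^ k; M) → H^p_I(M)` into the direct limit. -/
def ofPow (x : Fin m → R) (p : ℤ) (k : ℕ) :
    Koszul.Cohomology M (x ^ k) p →ₗ[R] LocalCohomology M x p :=
  Module.DirectLimit.of R ℕ (fun k : ℕ => Koszul.Cohomology M (x ^ k) p)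
    (LocalCohomology.transition M x p) k

/-- The canonical homomorphism `f^p : H^p(x; M) → H^p_I(M)` from Koszul cohomology, the first
term of the direct system, to local cohomology, its direct limit. The first arrow is the
identification of `H^p(x; M)` with `H^p(x ^ 1; M)` given by the identity on cochains. -/
def canonical (x : Fin m → R) (p : ℤ) :
    Koszul.Cohomology M x p →ₗ[R] LocalCohomology M x p :=
  ofPow M x p 1 ∘ₗ
    Koszul.cohomologyMap M (1 : Fin m → R) ((one_mul x).trans (pow_one x).symm) p

end

section

variable {A : Type*} [CommRing A] {q : Ideal A} {m : ℕ}

/-- The Koszul cocycles of cohomological degree `p` and internal degree `n` for elements `y i` of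
the form ring that are homogeneous of degree `e i`. The Koszul cochain module is the direct sum
of the copies `G(∑ i ∈ I, e i) e_I`, so the coefficient of `e_I` has degree
`n + ∑ i ∈ I, e i`. -/
def homogeneousCocycles (y : Fin m → FormRing q) (e : Fin m → ℕ) (p n : ℤ) :
    AddSubgroup ↥(Koszul.cocycles (FormRing q) y p) where
  carrier := {z | ∀ I : Finset (Fin m),
    (z : Koszul.Cochains m (FormRing q)) I ∈ FormRing.piece q (n + ∑ i ∈ I, (e i : ℤ))}
  zero_mem' _ := AddSubgroup.zero_mem _
  add_mem' hz hw I := AddSubgroup.add_mem _ (hz I) (hw I)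
  neg_mem' hz I := AddSubgroup.neg_mem _ (hz I)

/-- The graded piece `[H^p_Q(G)]_n`, `n ∈ ℤ`, where the generators `x i` of `Q` are homogeneous of
degree `e i`: the classes of all cocycles of internal degree `n` in the Koszul complexes of the
powers `x ^ k`. -/
def piece (x : Fin m → FormRing q) (e : Fin m → ℕ) (p n : ℤ) :
    AddSubgroup (LocalCohomology (FormRing q) x p) :=
  ⨆ k : ℕ, AddSubgroup.map
    (ofPow (FormRing q) x p k ∘ₗ Koszul.cls (FormRing q) (x ^ k) p).toAddMonoidHom
    (homogeneousCocycles (x ^ k) (fun i => k * e i) p n)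

end

end LocalCohomology

end

/-!
The statement is usually derived from the spectral sequence
`H^a(x; H^b_Q(G)) ⇒ H^{a+b}(x; G)`: as `Q` kills `H^b_Q(G)` for `b < t`, its initial terms are sums
of shifted copies of `H^b_Q(G)`, and the condition on degrees makes the differentials leaving the
terms with `a = 0` vanish. Here the spectral sequence is replaced by an induction that passes from
local cohomology to Koszul cohomology one element at a time.

For a set `S` of indices, give the elements `x i` with `i ∈ S` the exponent `1` and all others a
common exponent `k` (`mixedExp S k`), and let `H_S` be the direct limit over `k` of the resulting
Koszul cohomology. Then `H_∅` is local cohomology, and for the full set of indices `H_S` is Koszul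
cohomology. For `s ∉ S` there is an exact sequence
`H^{p-1}_S → H^p_{S ∪ {s}} → H^p_S → H^p_S`, whose last map is multiplication by `x s`; it is used
only through explicit formulas on cochains, written in terms of exterior multiplication by `e_s`,
contraction against `e_s`, and the Cartan formula `d_contract`:

* a class of `H_S` killed by `x s` lifts (`d_drop_add_wedge`, `scale_eq_scale_drop_add_wedge`,
  `limitClass_drop_add_wedge`);
* a class that dies in `H_S` comes from `H^{p-1}_S`
  (`d_contract_sub`, `scale_eq_d_of_contract_sub`).

First let `S` consist of elements of degree one. The second point shows by induction on `S` that
the component of degree `n` of `H^p_S` embeds into local cohomology if the components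
`[H^{p-1-r}_Q(G)]_{n+1+r}`, `r ≥ 0`, vanish (`exists_scale_mixedExp_mem_coboundaries`). Now take a
nonzero homogeneous class of degree `n` in `H^p_Q(G)` and a lift of it to `H_S`. The product of
the lift with `x s` has degree `n + 1` and dies in local cohomology, because `Q` kills the latter;
so it is zero, as the hypothesis on degrees says exactly that `[H^{p-1-r}_Q(G)]_{n+2+r} = 0`. Hence
the class lifts further (`exists_homogeneous_limitClass_mixedExp_eq`).

The generators of degree one already generate `Q`, because the form ring is generated in degree
one (`initialIdeal_le_span_degree_one`). Once their exponents are `1`, all of `Q` acts as zero on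
the Koszul cohomology, and the remaining exponents can be lowered without any condition on degrees
(`mem_range_canonical_of_limitClass_mixedExp`).
-/

noncomputable section

/-! ### Exterior multiplication and contraction on Koszul cochains -/

namespace Koszul

variable {R : Type*} [CommRing R] {M : Type*} [AddCommGroup M] [Module R M] {m : ℕ}

theorem d_apply (y : Fin m → R) (c : Cochains m M) (J : Finset (Fin m)) :
    d M y c J = ∑ j ∈ J, (-1 : R) ^ (J.filter (· < j)).card • y j • c (J.erase j) :=
  rfl

theorem d_add (y y' : Fin m → R) (c : Cochains m M) :
    d M (y + y') c = d M y c + d M y' c := by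
  ext J
  simp only [d_apply, Pi.add_apply, add_smul, smul_add, Finset.sum_add_distrib]

theorem d_smul (r : R) (y : Fin m → R) (c : Cochains m M) :
    d M (r • y) c = r • d M y c := by
  ext J
  simp only [d_apply, Pi.smul_apply, smul_eq_mul, Finset.smul_sum]
  refine Finset.sum_congr rfl fun j _ => ?_
  rw [mul_smul, smul_comm _ r]

variable (R) in
/-- Exterior multiplication `c ↦ e_s ∧ c` on Koszul cochains. -/
def wedge (s : Fin m) : Cochains m M →ₗ[R] Cochains m M :=
  d M (Pi.single s 1)

variable (R) in
/-- Contraction against `e_s`: it sends `e_s ∧ e_J` to `e_J` if `s ∉ J`, and it kills the `e_J`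
with `s ∉ J`. -/
def contract (s : Fin m) : Cochains m M →ₗ[R] Cochains m M where
  toFun c J := if s ∈ J then 0 else (-1 : R) ^ (J.filter (· < s)).card • c (insert s J)
  map_add' c c' := by
    ext J
    by_cases h : s ∈ J <;> simp [h]
  map_smul' r c := by
    ext J
    by_cases h : s ∈ J
    · simp [h]
    · simp only [h, if_false, Pi.smul_apply, RingHom.id_apply]
      rw [smul_comm]

variable (R) in
/-- The projection of Koszul cochains that kills the `e_J` with `s ∈ J`. -/
def drop (s : Fin m) : Cochains m M →ₗ[R] Cochains m M where
  toFun c J := if s ∈ J then 0 else c J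
  map_add' c c' := by
    ext J
    by_cases h : s ∈ J <;> simp [h]
  map_smul' r c := by
    ext J
    by_cases h : s ∈ J <;> simp [h]

theorem wedge_apply (s : Fin m) (c : Cochains m M) (J : Finset (Fin m)) :
    wedge R s c J =
      if s ∈ J then (-1 : R) ^ (J.filter (· < s)).card • c (J.erase s) else 0 := by
  rw [wedge, d_apply]
  split_ifs with h
  · rw [Finset.sum_eq_single_of_mem s h]
    · simp
    · intro j _ hj
      simp [Pi.single_eq_of_ne hj]
  · refine Finset.sum_eq_zero fun j hj => ?_
    have : j ≠ s := fun e => h (e ▸ hj)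
    simp [Pi.single_eq_of_ne this]

theorem contract_apply (s : Fin m) (c : Cochains m M) (J : Finset (Fin m)) :
    contract R s c J =
      if s ∈ J then 0 else (-1 : R) ^ (J.filter (· < s)).card • c (insert s J) :=
  rfl

theorem drop_apply (s : Fin m) (c : Cochains m M) (J : Finset (Fin m)) :
    drop R s c J = if s ∈ J then 0 else c J :=
  rfl

theorem neg_one_pow_smul_self (k : ℕ) (c : M) : (-1 : R) ^ k • (-1 : R) ^ k • c = c := by
  rw [smul_smul, ← mul_pow]
  simp

/-- The Cartan formula: contraction against `e_s` is a homotopy from multiplication by `y s` to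
zero on the Koszul complex of `y`. -/
theorem d_contract (y : Fin m → R) (s : Fin m) (c : Cochains m M) :
    d M y (contract R s c) + contract R s (d M y c) = y s • c := by
  ext J
  rw [Pi.add_apply, Pi.smul_apply, contract_apply, d_apply]
  by_cases hs : s ∈ J
  · rw [if_pos hs, add_zero, Finset.sum_eq_single_of_mem s hs]
    · rw [contract_apply, if_neg (Finset.notMem_erase s J), Finset.insert_erase hs,
        smul_comm (y s), Finset.filter_erase, Finset.erase_eq_of_notMem (by simp),
        neg_one_pow_smul_self]
    · intro j _ hj
      rw [contract_apply, if_pos (Finset.mem_erase.2 ⟨hj.symm, hs⟩), smul_zero, smul_zero]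
  · rw [if_neg hs, d_apply, Finset.sum_insert hs, smul_add, Finset.erase_insert hs,
      Finset.filter_insert, if_neg (lt_irrefl s), neg_one_pow_smul_self, Finset.smul_sum,
      add_left_comm, ← Finset.sum_add_distrib, add_eq_left]
    refine Finset.sum_eq_zero fun j hj => ?_
    have hjs : j ≠ s := fun e => hs (e ▸ hj)
    rw [contract_apply, if_neg (fun h => hs (Finset.mem_of_mem_erase h)),
      Finset.erase_insert_of_ne hjs.symm]
    simp only [smul_smul]
    rw [← add_smul]
    convert zero_smul R _
    have h1 := card_filter_erase J j s hj
    have h2 : ((insert s J).filter (· < j)).card =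
        (J.filter (· < j)).card + (if s < j then 1 else 0) := by
      rw [Finset.filter_insert]
      split_ifs with h
      · exact Finset.card_insert_of_notMem (by simp [hs])
      · rfl
    rw [h2, ← h1]
    rcases lt_or_gt_of_ne hjs with h | h
    · rw [if_pos h, if_neg (not_lt.2 h.le)]; ring
    · rw [if_neg (not_lt.2 h.le), if_pos h]; ring

theorem wedge_contract_add_drop (s : Fin m) (c : Cochains m M) :
    wedge R s (contract R s c) + drop R s c = c := by
  ext J
  rw [Pi.add_apply, wedge_apply, drop_apply]
  split_ifs with hs
  · rw [contract_apply, if_neg (Finset.notMem_erase s J), Finset.insert_erase hs,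
      Finset.filter_erase, Finset.erase_eq_of_notMem (by simp), neg_one_pow_smul_self, add_zero]
  · rw [zero_add]

theorem contract_wedge (s : Fin m) (c : Cochains m M) :
    contract R s (wedge R s c) = drop R s c := by
  have h := d_contract (Pi.single s (1 : R)) s c
  rw [Pi.single_eq_same, one_smul] at h
  have h' := wedge_contract_add_drop (R := R) s c
  exact add_left_cancel (h.trans h'.symm)

theorem wedge_wedge (s : Fin m) (c : Cochains m M) : wedge R s (wedge R s c) = 0 :=
  d_d _ _

theorem drop_wedge (s : Fin m) (c : Cochains m M) : drop R s (wedge R s c) = 0 := by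
  rw [← contract_wedge, wedge_wedge, map_zero]

theorem drop_drop (s : Fin m) (c : Cochains m M) : drop R s (drop R s c) = drop R s c := by
  ext J
  by_cases h : s ∈ J <;> simp [drop_apply, h]

theorem wedge_drop (s : Fin m) (c : Cochains m M) : wedge R s (drop R s c) = wedge R s c := by
  conv_rhs => rw [← wedge_contract_add_drop (R := R) s c, map_add, wedge_wedge, zero_add]

theorem contract_drop (s : Fin m) (c : Cochains m M) : contract R s (drop R s c) = 0 := by
  ext J
  by_cases h : s ∈ J <;> simp [drop_apply, contract_apply, h]

theorem drop_contract (s : Fin m) (c : Cochains m M) :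
    drop R s (contract R s c) = contract R s c := by
  ext J
  by_cases h : s ∈ J <;> simp [drop_apply, contract_apply, h]

theorem d_update (y : Fin m → R) (s : Fin m) (r : R) (c : Cochains m M) :
    d M (Function.update y s r) c = d M (Function.update y s 0) c + r • wedge R s c := by
  rw [wedge, ← d_smul, ← d_add]
  congr 2
  ext j
  by_cases h : j = s
  · subst h; simp
  · simp [h]

theorem d_update_zero_wedge (y : Fin m → R) (s : Fin m) (c : Cochains m M) :
    d M (Function.update y s 0) (wedge R s c) = -wedge R s (d M (Function.update y s 0) c) := by
  have h := d_d (Function.update y s 1) c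
  rw [d_update y s 1, d_update y s 1, one_smul, one_smul, map_add, map_add, d_d, wedge_wedge,
    zero_add, add_zero] at h
  exact eq_neg_of_add_eq_zero_left h

theorem contract_d_update_zero (y : Fin m → R) (s : Fin m) (c : Cochains m M) :
    contract R s (d M (Function.update y s 0) c) =
      -d M (Function.update y s 0) (contract R s c) := by
  have h := d_contract (Function.update y s 0) s c
  rw [Function.update_self, zero_smul] at h
  exact eq_neg_of_add_eq_zero_right h

theorem drop_d_update_zero (y : Fin m → R) (s : Fin m) (c : Cochains m M) :
    drop R s (d M (Function.update y s 0) c) = d M (Function.update y s 0) (drop R s c) := by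
  rw [← contract_wedge, ← contract_wedge, ← neg_neg (wedge R s _), ← d_update_zero_wedge,
    map_neg, contract_d_update_zero, neg_neg]

theorem scale_apply (a : Fin m → R) (c : Cochains m M) (J : Finset (Fin m)) :
    scale M a c J = (∏ i ∈ J, a i) • c J :=
  rfl

theorem scale_one (c : Cochains m M) : scale M (1 : Fin m → R) c = c := by
  ext J
  simp [scale_apply]

theorem scale_scale (a b : Fin m → R) (c : Cochains m M) :
    scale M a (scale M b c) = scale M (a * b) c := by
  ext J
  simp [scale_apply, smul_smul, Finset.prod_mul_distrib]

theorem scale_update_one (s : Fin m) (r : R) (c : Cochains m M) :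
    scale M (Function.update 1 s r) c = drop R s c + r • wedge R s (contract R s c) := by
  have h : wedge R s (contract R s c) = c - drop R s c :=
    eq_sub_of_add_eq (wedge_contract_add_drop s c)
  ext J
  rw [h, scale_apply]
  by_cases hs : s ∈ J
  · rw [Finset.prod_update_of_mem hs]
    simp [drop_apply, hs]
  · rw [Finset.prod_update_of_notMem hs]
    simp [drop_apply, hs]

/-- Scaling commutes with dropping the `e_J` with `s ∈ J`, and the factor at `s` is then
irrelevant. -/
theorem drop_scale (a : Fin m → R) (s : Fin m) (r : R) (c : Cochains m M) :
    drop R s (scale M a c) = scale M (Function.update a s r) (drop R s c) := by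
  ext J
  rw [drop_apply, scale_apply, scale_apply, drop_apply]
  split_ifs with hs
  · rw [smul_zero]
  · rw [Finset.prod_update_of_notMem hs]

theorem scale_wedge (a : Fin m → R) (s : Fin m) (c : Cochains m M) :
    scale M a (wedge R s c) = a s • wedge R s (scale M a c) := by
  rw [wedge, ← d_scale, ← d_smul]
  congr 2
  ext j
  by_cases h : j = s
  · subst h; simp
  · simp [h]

theorem contract_mem_degree (s : Fin m) {p : ℤ} {c : Cochains m M} (hc : c ∈ degree R M m p) :
    contract R s c ∈ degree R M m (p - 1) := fun J hJ => by
  rw [contract_apply]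
  split_ifs with hs
  · rfl
  · rw [hc _ (by rw [Finset.card_insert_of_notMem hs]; push_cast; omega), smul_zero]

theorem drop_mem_degree (s : Fin m) {p : ℤ} {c : Cochains m M} (hc : c ∈ degree R M m p) :
    drop R s c ∈ degree R M m p := fun J hJ => by
  rw [drop_apply, hc _ hJ, ite_self]

theorem wedge_mem_degree (s : Fin m) {p : ℤ} {c : Cochains m M}
    (hc : c ∈ degree R M m (p - 1)) : wedge R s c ∈ degree R M m p :=
  d_mem_degree _ hc

/-! ### Changing one element of a Koszul complex -/

section Lift

variable {y : Fin m → R} {s : Fin m} {r u : R} {z w : Cochains m M}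

/-- Let `z` be a cocycle of the Koszul complex of `y` with `u • z = d w`. Then `drop z + e_s ∧ w`
is a cocycle of the complex in which `y s` is replaced by `u`. -/
theorem d_drop_add_wedge (hy : y s = r) (hz : d M y z = 0) (hw : u • z = d M y w) :
    d M (Function.update y s u) (drop R s z + wedge R s w) = 0 := by
  rw [← Function.update_eq_self s y, d_update, hy] at hz hw
  rw [d_update, map_add, map_add, wedge_wedge, wedge_drop, ← drop_d_update_zero,
    d_update_zero_wedge, eq_neg_of_add_eq_zero_left hz, eq_sub_of_add_eq hw.symm, map_neg,
    map_smul, drop_wedge, map_sub, map_smul, map_smul, wedge_wedge]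
  simp

/-- In the situation of `d_drop_add_wedge`, the two cocycles become cohomologous in the complex
in which `y s` is replaced by `u * y s`. -/
theorem scale_eq_scale_drop_add_wedge (hy : y s = r) (hw : u • z = d M y w) :
    scale M (Function.update 1 s u) z =
      scale M (Function.update 1 s r) (drop R s z + wedge R s w) +
        d M (Function.update y s (u * r)) (wedge R s (contract R s w)) := by
  rw [← Function.update_eq_self s y, d_update, hy] at hw
  have h := congrArg (fun c => wedge R s (contract R s c)) hw
  simp only [map_add, map_smul, contract_d_update_zero, contract_wedge, wedge_drop, map_neg] at h
  rw [← d_update_zero_wedge] at h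
  rw [scale_update_one, scale_update_one, d_update, h, wedge_wedge]
  simp only [map_add, contract_drop, contract_wedge, drop_drop, drop_wedge, wedge_drop, map_zero]
  simp only [smul_zero, add_zero, zero_add]
  rw [add_assoc, add_comm (r • _)]

end Lift

section Vanish

variable {y : Fin m → R} {s : Fin m} {r u : R} {z w : Cochains m M}

/-- Let `z` be a cocycle of the Koszul complex of `y` that becomes the coboundary of `w` when
`y s = u` is replaced by `u * r`. Then `contract z - u • w` is a cocycle of the latter complex;
it represents a preimage of the class of `z` under the connecting homomorphism. -/
theorem d_contract_sub (hy : y s = u) (hz : d M y z = 0)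
    (hw : scale M (Function.update 1 s r) z = d M (Function.update y s (u * r)) w) :
    d M (Function.update y s (u * r)) (contract R s z - u • w) = 0 := by
  rw [← Function.update_eq_self s y, d_update, hy] at hz
  have h := congrArg (contract R s) hz
  rw [map_add, map_smul, contract_d_update_zero, contract_wedge, map_zero] at h
  rw [map_sub, map_smul, ← hw, d_update, scale_update_one,
    ← sub_eq_zero.1 ((sub_eq_neg_add _ _).trans h)]
  module

/-- In the situation of `d_contract_sub`, if the cocycle `contract z - u • w` becomes a coboundary
after multiplying the elements by `a`, then `z` becomes a coboundary after multiplying the elements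
other than `y s` by `a`. -/
theorem scale_eq_d_of_contract_sub {a : Fin m → R} {g : Cochains m M} (hy : y s = u)
    (hw : scale M (Function.update 1 s r) z = d M (Function.update y s (u * r)) w)
    (hg : scale M a (contract R s z - u • w) =
      d M (a * Function.update y s (u * r)) g) :
    scale M (Function.update a s 1) z =
      d M (Function.update a s 1 * y)
        (scale M (Function.update a s 1) (drop R s w) - wedge R s (drop R s g)) := by
  have e1 : Function.update a s 1 * y = Function.update (a * y) s u := by
    ext j
    by_cases h : j = s
    · subst h; simp [hy]
    · simp [h]
  have e2 : a * Function.update y s (u * r) =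
      Function.update (a * y) s (a s * (u * r)) := by
    ext j
    by_cases h : j = s
    · subst h; simp
    · simp [h]
  have hdw := congrArg (drop R s) hw
  rw [scale_update_one, d_update, map_add, map_add, map_smul, map_smul, drop_wedge, drop_wedge,
    smul_zero, smul_zero, add_zero, add_zero, drop_drop, drop_d_update_zero] at hdw
  have hdg := congrArg (drop R s) hg
  rw [drop_scale a s 1, map_sub, map_smul, e2, d_update, map_add, map_smul, drop_wedge, smul_zero,
    add_zero, drop_d_update_zero] at hdg
  rw [drop_contract] at hdg
  have h1 : d M y (drop R s w) = drop R s z + u • wedge R s w := by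
    rw [← Function.update_eq_self s y, d_update, hy, ← hdw, wedge_drop]
  have h2 : d M (Function.update a s 1 * y) (wedge R s (drop R s g)) =
      -scale M (Function.update a s 1) (wedge R s (contract R s z) - u • wedge R s w) := by
    have h3 := scale_wedge (Function.update a s 1) s (contract R s z - u • drop R s w)
    rw [Function.update_self, one_smul, map_sub (wedge R s), map_smul, wedge_drop] at h3
    rw [h3, e1, d_update, wedge_wedge, smul_zero, add_zero, d_update_zero_wedge, hdg]
  rw [map_sub, d_scale, h1, h2, sub_neg_eq_add, ← map_add]
  congr 1
  conv_lhs => rw [← wedge_contract_add_drop (R := R) s z]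
  abel

end Vanish

end Koszul

/-! ### The grading of the form ring -/

namespace FormRing

variable {A : Type*} [CommRing A] {q : Ideal A}

theorem coeff_of_same (n : ℕ) (v : FormPiece q n) : coeff q n (of q n v) = v :=
  DirectSum.of_eq_same n v

theorem coeff_of_ne {n k : ℕ} (h : n ≠ k) (v : FormPiece q n) : coeff q k (of q n v) = 0 :=
  DirectSum.of_eq_of_ne n k v h.symm

theorem ext_coeff {g h : FormRing q} (H : ∀ n, coeff q n g = coeff q n h) : g = h :=
  DFinsupp.ext H

theorem of_mul_of {i j : ℕ} (u : FormPiece q i) (v : FormPiece q j) :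
    of q i u * of q j v = of q (i + j) (GradedMonoid.GMul.mul u v) :=
  DirectSum.of_mul_of u v

@[elab_as_elim]
theorem induction_of {P : FormRing q → Prop} (g : FormRing q) (zero : P 0)
    (of : ∀ (n : ℕ) (v : FormPiece q n), P (of q n v))
    (add : ∀ g h, P g → P h → P (g + h)) : P g :=
  DirectSum.induction_on g zero of add

theorem of_mem_piece (n : ℕ) (v : FormPiece q n) : of q n v ∈ piece q n := fun k hk =>
  coeff_of_ne (fun h => hk (by rw [h])) v

/-- A homogeneous element is zero or lies in the image of one of the components. -/
theorem eq_zero_or_eq_of {k : ℤ} {g : FormRing q} (hg : g ∈ piece q k) :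
    g = 0 ∨ ∃ (n : ℕ) (v : FormPiece q n), (n : ℤ) = k ∧ g = of q n v := by
  by_cases hk : 0 ≤ k
  · obtain ⟨n, rfl⟩ := Int.eq_ofNat_of_zero_le hk
    refine Or.inr ⟨n, coeff q n g, rfl, ext_coeff fun j => ?_⟩
    by_cases hj : n = j
    · subst hj
      rw [coeff_of_same]
    · rw [coeff_of_ne hj]
      exact hg j fun h => hj (Nat.cast_injective h).symm
  · exact Or.inl (ext_coeff fun j => by rw [hg j (by omega), map_zero])

theorem eq_zero_of_mem_piece_neg {k : ℤ} (hk : k < 0) {g : FormRing q} (hg : g ∈ piece q k) :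
    g = 0 :=
  ext_coeff fun j => by rw [hg j (by omega), map_zero]

theorem mul_mem_piece {k l : ℤ} {g h : FormRing q} (hg : g ∈ piece q k) (hh : h ∈ piece q l) :
    g * h ∈ piece q (k + l) := by
  obtain rfl | ⟨i, u, rfl, rfl⟩ := eq_zero_or_eq_of hg
  · rw [zero_mul]; exact zero_mem _
  obtain rfl | ⟨j, v, rfl, rfl⟩ := eq_zero_or_eq_of hh
  · rw [mul_zero]; exact zero_mem _
  rw [of_mul_of, ← Nat.cast_add]
  exact of_mem_piece _ _

theorem pow_mem_piece {k : ℕ} {g : FormRing q} (hg : g ∈ piece q k) (r : ℕ) :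
    g ^ r ∈ piece q ((r * k : ℕ) : ℤ) := by
  induction r with
  | zero =>
    rw [pow_zero, zero_mul]
    exact of_mem_piece 0 (GradedMonoid.GOne.one : FormPiece q 0)
  | succ r ih =>
    have := mul_mem_piece ih hg
    rw [pow_succ, add_mul, one_mul]
    exact_mod_cast this

variable (q) in
/-- The projection of the form ring onto its elements of degree `k ∈ ℤ`. -/
def proj (k : ℤ) : FormRing q →+ FormRing q :=
  if 0 ≤ k then (of q k.toNat).comp (coeff q k.toNat) else 0

theorem proj_of (k : ℤ) (n : ℕ) (v : FormPiece q n) :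
    proj q k (of q n v) = if (n : ℤ) = k then of q n v else 0 := by
  rw [proj]
  by_cases hk : 0 ≤ k
  · obtain ⟨j, rfl⟩ := Int.eq_ofNat_of_zero_le hk
    rw [if_pos hk, AddMonoidHom.comp_apply]
    change of q j (coeff q j (of q n v)) = _
    by_cases hj : n = j
    · subst hj
      rw [coeff_of_same, if_pos rfl]
    · rw [coeff_of_ne hj, map_zero, if_neg (by exact_mod_cast hj)]
  · rw [if_neg hk, if_neg (by omega)]
    rfl

theorem proj_mem (k : ℤ) (g : FormRing q) : proj q k g ∈ piece q k := by
  induction g using induction_of with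
  | zero => rw [map_zero]; exact zero_mem _
  | of n v =>
    rw [proj_of]
    split_ifs with h
    · rw [← h]; exact of_mem_piece n v
    · exact zero_mem _
  | add g h hg hh => rw [map_add]; exact add_mem hg hh

theorem proj_of_mem {k : ℤ} {g : FormRing q} (hg : g ∈ piece q k) : proj q k g = g := by
  obtain rfl | ⟨n, v, hn, rfl⟩ := eq_zero_or_eq_of hg
  · rw [map_zero]
  · rw [proj_of, if_pos hn]

theorem proj_neg {k : ℤ} (hk : k < 0) (g : FormRing q) : proj q k g = 0 :=
  eq_zero_of_mem_piece_neg hk (proj_mem k g)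

theorem proj_mul {l : ℤ} {a : FormRing q} (ha : a ∈ piece q l) (k : ℤ) (g : FormRing q) :
    proj q k (a * g) = a * proj q (k - l) g := by
  obtain rfl | ⟨i, u, rfl, rfl⟩ := eq_zero_or_eq_of ha
  · rw [zero_mul, zero_mul, map_zero]
  induction g using induction_of with
  | zero => rw [mul_zero, map_zero, map_zero, mul_zero]
  | of n v =>
    rw [of_mul_of, proj_of, proj_of, mul_ite, mul_zero, of_mul_of]
    refine if_congr ?_ rfl rfl
    push_cast
    constructor <;> intro h <;> linarith
  | add g h hg hh => rw [mul_add, map_add, map_add, mul_add, hg, hh]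

/-- Every element is the sum of its homogeneous components, over any large enough finite set of
degrees. -/
theorem exists_sum_proj (g : FormRing q) :
    ∃ F : Finset ℤ, ∀ F' : Finset ℤ, F ⊆ F' → ∑ k ∈ F', proj q k g = g := by
  induction g using induction_of with
  | zero => exact ⟨∅, fun F' _ => Finset.sum_eq_zero fun k _ => map_zero _⟩
  | of n v =>
    refine ⟨{(n : ℤ)}, fun F' hF' => ?_⟩
    simp only [proj_of]
    rw [Finset.sum_ite_eq, if_pos (hF' (Finset.mem_singleton_self _))]
  | add g h hg hh =>
    obtain ⟨F, hF⟩ := hg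
    obtain ⟨F', hF'⟩ := hh
    refine ⟨F ∪ F', fun E hE => ?_⟩
    simp only [map_add, Finset.sum_add_distrib]
    rw [hF _ (Finset.union_subset_left hE), hF' _ (Finset.union_subset_right hE)]

/-- An ideal that contains all elements of degree one contains all those of positive degree, since
`q ^ (n + 1)` is generated by products of elements of `q ^ n` and of `q`. -/
theorem of_succ_mem {I : Ideal (FormRing q)} (hI : ∀ v : FormPiece q 1, of q 1 v ∈ I) (n : ℕ)
    (v : FormPiece q (n + 1)) : of q (n + 1) v ∈ I := by
  obtain ⟨⟨a, ha⟩, rfl⟩ := FormPiece.cls_surjective _ v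
  have ha' := ha
  rw [pow_succ] at ha'
  induction ha' using Submodule.mul_induction_on' with
  | mem_mul_mem b hb c hc =>
    have h := I.mul_mem_left (of q n (FormPiece.cls n ⟨b, hb⟩))
      (hI (FormPiece.cls 1 ⟨c, by rwa [pow_one]⟩))
    rw [of_mul_of] at h
    exact h
  | add b hb c hc hb' hc' =>
    rw [← pow_succ] at hb hc
    have h := I.add_mem (hb' hb) (hc' hc)
    rwa [← map_add, ← map_add] at h

theorem proj_zero_of_mem_initialIdeal {g : FormRing q} (hg : g ∈ initialIdeal q) :
    proj q 0 g = 0 := by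
  induction hg using Submodule.span_induction with
  | mem g h =>
    obtain ⟨a, ha, n, hn, hn', rfl⟩ := h
    rw [proj_of, if_neg]
    rintro h
    obtain rfl : n = 0 := by exact_mod_cast h
    exact hn' (by simpa using ha)
  | zero => exact map_zero _
  | add g h _ _ hg hh => rw [map_add, hg, hh, add_zero]
  | smul a g _ hg =>
    rw [smul_eq_mul]
    induction a using induction_of with
    | zero => rw [zero_mul, map_zero]
    | of n v =>
      rw [proj_mul (of_mem_piece n v)]
      rcases Nat.eq_zero_or_pos n with rfl | hn
      · rw [Nat.cast_zero, sub_zero, hg, mul_zero]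
      · rw [proj_neg (by omega), mul_zero]
    | add a b ha hb => rw [add_mul, map_add, ha, hb, add_zero]

/-- Since the form ring is generated in degree one, any system of homogeneous generators of
`initialIdeal q` can be thinned out to its members of degree one. -/
theorem initialIdeal_le_span_degree_one {m : ℕ} {x : Fin m → FormRing q} {e : Fin m → ℕ}
    (hxe : ∀ i, x i ∈ piece q (e i)) (hx : Ideal.span (Set.range x) = initialIdeal q) :
    initialIdeal q ≤ Ideal.span (x '' {i | e i = 1}) := by
  set I := Ideal.span (x '' {i | e i = 1})
  have h1 : ∀ v : FormPiece q 1, of q 1 v ∈ I := by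
    intro v
    obtain ⟨⟨a, ha⟩, rfl⟩ := FormPiece.cls_surjective _ v
    by_cases ha' : a ∈ q ^ (1 + 1)
    · rw [(FormPiece.cls_eq_zero _).2 ha', map_zero]
      exact zero_mem _
    have h : of q 1 (FormPiece.cls 1 ⟨a, ha⟩) ∈ initialIdeal q :=
      Ideal.subset_span ⟨a, by simpa using ha, 1, ha, ha', rfl⟩
    rw [← hx, Ideal.mem_span_range_iff_exists_fun] at h
    obtain ⟨c, hc⟩ := h
    rw [← proj_of_mem (of_mem_piece 1 (FormPiece.cls 1 ⟨a, ha⟩)), ← hc, map_sum]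
    refine sum_mem fun i _ => ?_
    rw [mul_comm, proj_mul (hxe i)]
    have hi : x i ∈ initialIdeal q := hx ▸ Ideal.subset_span ⟨i, rfl⟩
    rcases lt_trichotomy (e i) 1 with h | h | h
    · have h0 := proj_zero_of_mem_initialIdeal hi
      rw [proj_of_mem (by simpa [Nat.lt_one_iff.1 h] using hxe i)] at h0
      rw [h0, zero_mul]
      exact zero_mem _
    · exact I.mul_mem_right _ (Ideal.subset_span ⟨i, h, rfl⟩)
    · rw [proj_neg (by push_cast; omega), mul_zero]
      exact zero_mem _
  refine Ideal.span_le.2 ?_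
  rintro _ ⟨a, ha, n, hn, hn', rfl⟩
  cases n with
  | zero => exact absurd (by simpa using ha) hn'
  | succ n => exact of_succ_mem h1 n _

end FormRing

/-! ### The internal grading of Koszul cochains -/

namespace Koszul

open FormRing

variable {A : Type*} [CommRing A] {q : Ideal A} {m : ℕ}

variable (q) in
/-- The Koszul cochains of internal degree `n` over the form ring, where `e_i` has degree
`-e i`: the coefficient of `e_I` is homogeneous of degree `n + ∑ i ∈ I, e i`. -/
def homogeneous (e : Fin m → ℕ) (n : ℤ) : AddSubgroup (Cochains m (FormRing q)) where
  carrier := {c | ∀ I : Finset (Fin m), c I ∈ piece q (n + ∑ i ∈ I, (e i : ℤ))}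
  zero_mem' _ := AddSubgroup.zero_mem _
  add_mem' hz hw I := AddSubgroup.add_mem _ (hz I) (hw I)
  neg_mem' hz I := AddSubgroup.neg_mem _ (hz I)

variable (q) in
/-- The projection of the Koszul cochains onto those of internal degree `n`. -/
def component (e : Fin m → ℕ) (n : ℤ) :
    Cochains m (FormRing q) →+ Cochains m (FormRing q) where
  toFun c I := proj q (n + ∑ i ∈ I, (e i : ℤ)) (c I)
  map_zero' := by ext I; simp
  map_add' c c' := by ext I; simp

theorem component_apply (e : Fin m → ℕ) (n : ℤ) (c : Cochains m (FormRing q))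
    (I : Finset (Fin m)) : component q e n c I = proj q (n + ∑ i ∈ I, (e i : ℤ)) (c I) :=
  rfl

theorem component_mem (e : Fin m → ℕ) (n : ℤ) (c : Cochains m (FormRing q)) :
    component q e n c ∈ homogeneous q e n := fun _ => proj_mem _ _

theorem component_of_mem {e : Fin m → ℕ} {n : ℤ} {c : Cochains m (FormRing q)}
    (hc : c ∈ homogeneous q e n) : component q e n c = c :=
  funext fun I => proj_of_mem (hc I)

theorem component_mem_degree (e : Fin m → ℕ) (n : ℤ) {p : ℤ} {c : Cochains m (FormRing q)}
    (hc : c ∈ degree (FormRing q) (FormRing q) m p) :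
    component q e n c ∈ degree (FormRing q) (FormRing q) m p := fun I hI => by
  rw [component_apply, hc I hI, map_zero]

theorem exists_sum_component (e : Fin m → ℕ) (c : Cochains m (FormRing q)) :
    ∃ F : Finset ℤ, ∑ n ∈ F, component q e n c = c := by
  choose F hF using fun I => exists_sum_proj (c I)
  refine ⟨Finset.univ.biUnion fun I => (F I).image fun k => k - ∑ i ∈ I, (e i : ℤ),
    funext fun I => ?_⟩
  rw [Finset.sum_apply]
  simp only [component_apply]
  rw [← Finset.sum_image (f := fun k => proj q k (c I))
    (fun a _ b _ h => by simpa using h)]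
  refine hF I _ fun k hk => ?_
  refine Finset.mem_image.2 ⟨k - ∑ i ∈ I, (e i : ℤ), ?_, by ring⟩
  exact Finset.mem_biUnion.2 ⟨I, Finset.mem_univ I, Finset.mem_image_of_mem _ hk⟩

theorem neg_one_pow_smul_mem {k : ℤ} {g : FormRing q} (hg : g ∈ piece q k) (r : ℕ) :
    (-1 : FormRing q) ^ r • g ∈ piece q k := by
  rcases neg_one_pow_eq_or (FormRing q) r with h | h <;> simp [h, hg]

theorem sum_erase_weight (e : Fin m → ℕ) {J : Finset (Fin m)} {j : Fin m} (hj : j ∈ J) :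
    ∑ i ∈ J, (e i : ℤ) = e j + ∑ i ∈ J.erase j, (e i : ℤ) :=
  (Finset.add_sum_erase J (fun i => (e i : ℤ)) hj).symm

theorem component_d {y : Fin m → FormRing q} {e : Fin m → ℕ} (hy : ∀ i, y i ∈ piece q (e i))
    (n : ℤ) (c : Cochains m (FormRing q)) :
    component q e n (d (FormRing q) y c) = d (FormRing q) y (component q e n c) := by
  ext J
  rw [component_apply, d_apply, d_apply, map_sum]
  refine Finset.sum_congr rfl fun j hj => ?_
  have h : proj q (n + ∑ i ∈ J, (e i : ℤ)) (y j * c (J.erase j)) =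
      y j * component q e n c (J.erase j) := by
    rw [proj_mul (hy j), component_apply, sum_erase_weight e hj]
    congr 3; ring
  rcases neg_one_pow_eq_or (FormRing q) (J.filter (· < j)).card with h' | h' <;>
    simp [h', h]

theorem wedge_mem_homogeneous {e : Fin m → ℕ} {n : ℤ} {s : Fin m} {c : Cochains m (FormRing q)}
    (hc : c ∈ homogeneous q e (n + e s)) : wedge (FormRing q) s c ∈ homogeneous q e n :=
  fun J => by
    rw [wedge_apply]
    split_ifs with hs
    · have := hc (J.erase s)
      rw [add_assoc, ← sum_erase_weight e hs] at this
      exact neg_one_pow_smul_mem this _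
    · exact zero_mem _

theorem contract_mem_homogeneous {e : Fin m → ℕ} {n : ℤ} {s : Fin m}
    {c : Cochains m (FormRing q)} (hc : c ∈ homogeneous q e n) :
    contract (FormRing q) s c ∈ homogeneous q e (n + e s) := fun J => by
  rw [contract_apply]
  split_ifs with hs
  · exact zero_mem _
  · have := hc (insert s J)
    rw [Finset.sum_insert hs, ← add_assoc] at this
    exact neg_one_pow_smul_mem this _

theorem drop_mem_homogeneous {e e' : Fin m → ℕ} {n : ℤ} {s : Fin m}
    (he : ∀ i, i ≠ s → e i = e' i) {c : Cochains m (FormRing q)}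
    (hc : c ∈ homogeneous q e n) :
    drop (FormRing q) s c ∈ homogeneous q e' n := fun J => by
  rw [drop_apply]
  split_ifs with hs
  · exact zero_mem _
  · have : ∑ i ∈ J, (e i : ℤ) = ∑ i ∈ J, (e' i : ℤ) :=
      Finset.sum_congr rfl fun i hi => by rw [he i fun h => hs (h ▸ hi)]
    rw [← this]
    exact hc J

theorem smul_mem_homogeneous {e : Fin m → ℕ} {n : ℤ} {k : ℕ} {a : FormRing q}
    (ha : a ∈ piece q k) {c : Cochains m (FormRing q)} (hc : c ∈ homogeneous q e n) :
    a • c ∈ homogeneous q e (n + k) := fun J => by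
  rw [add_assoc, add_left_comm]
  exact mul_mem_piece ha (hc J)

theorem prod_mem_piece {a : Fin m → FormRing q} {f : Fin m → ℕ}
    (ha : ∀ i, a i ∈ piece q (f i)) (J : Finset (Fin m)) :
    ∏ i ∈ J, a i ∈ piece q (∑ i ∈ J, (f i : ℤ)) := by
  induction J using Finset.induction_on with
  | empty => exact of_mem_piece 0 (GradedMonoid.GOne.one : FormPiece q 0)
  | insert j J hj ih =>
    rw [Finset.prod_insert hj, Finset.sum_insert hj]
    exact mul_mem_piece (ha j) ih

theorem scale_mem_homogeneous {a : Fin m → FormRing q} {e f : Fin m → ℕ} {n : ℤ}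
    (ha : ∀ i, a i ∈ piece q (f i)) {c : Cochains m (FormRing q)}
    (hc : c ∈ homogeneous q e n) :
    scale (FormRing q) a c ∈ homogeneous q (fun i => f i + e i) n := fun J => by
  have := mul_mem_piece (prod_mem_piece ha J) (hc J)
  push_cast
  rw [Finset.sum_add_distrib, add_left_comm]
  exact this

/-- A homogeneous coboundary bounds a homogeneous cochain. -/
theorem exists_homogeneous_eq_d {y : Fin m → FormRing q} {e : Fin m → ℕ}
    (hy : ∀ i, y i ∈ piece q (e i)) {p n : ℤ} {z : Cochains m (FormRing q)}
    (hz : z ∈ homogeneous q e n) (hz' : z ∈ coboundaries (FormRing q) y p) :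
    ∃ w ∈ degree (FormRing q) (FormRing q) m (p - 1), w ∈ homogeneous q e n ∧
      z = d (FormRing q) y w := by
  obtain ⟨w, hw, hwz⟩ := hz'
  refine ⟨component q e n w, component_mem_degree e n hw, component_mem e n w, ?_⟩
  rw [← component_d hy, hwz, component_of_mem hz]

end Koszul

/-! ### Classes in local cohomology of cocycles with arbitrary exponents -/

namespace Koszul

variable {R : Type*} [CommRing R] {M : Type*} [AddCommGroup M] [Module R M] {m : ℕ}

theorem cls_surjective (y : Fin m → R) (p : ℤ) : Function.Surjective (cls M y p) :=
  Submodule.mkQ_surjective _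

theorem cls_eq_zero {y : Fin m → R} {p : ℤ} {z : ↥(cocycles M y p)} :
    cls M y p z = 0 ↔ (z : Cochains m M) ∈ coboundaries M y p := by
  rw [cls]
  exact Submodule.Quotient.mk_eq_zero _

theorem scale_mem_cocycles {a y y' : Fin m → R} (h : a * y = y') {p : ℤ} {z : Cochains m M}
    (hz : z ∈ cocycles M y p) : scale M a z ∈ cocycles M y' p := by
  refine ⟨scale_mem_degree a hz.1, ?_⟩
  change d M y' (scale M a z) = 0
  rw [← h, d_scale, LinearMap.mem_ker.1 hz.2, map_zero]

theorem cohomologyMap_cls {a y y' : Fin m → R} (h : a * y = y') {p : ℤ} {z : Cochains m M}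
    (hz : z ∈ cocycles M y p) : cohomologyMap M a h p (cls M y p ⟨z, hz⟩) =
      cls M y' p ⟨scale M a z, scale_mem_cocycles h hz⟩ :=
  rfl

end Koszul

namespace LocalCohomology

open Koszul

variable {R : Type*} [CommRing R] {M : Type*} [AddCommGroup M] [Module R M] {m : ℕ}

/-- The sequence `x 0 ^ a 0, …, x (m - 1) ^ a (m - 1)`. -/
def powSeq (x : Fin m → R) (a : Fin m → ℕ) : Fin m → R := fun i => x i ^ a i

theorem powSeq_sub_mul_powSeq (x : Fin m → R) {a b : Fin m → ℕ} (h : a ≤ b) :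
    powSeq x (b - a) * powSeq x a = powSeq x b :=
  funext fun i => pow_sub_mul_pow (x i) (h i)

theorem scale_powSeq_sub_self (x : Fin m → R) (a : Fin m → ℕ) (z : Cochains m M) :
    scale M (powSeq x (a - a)) z = z := by
  convert scale_one z
  ext i
  simp [powSeq]

theorem powSeq_sub_mul_powSeq_sub (x : Fin m → R) {a b c : Fin m → ℕ} (h : a ≤ b) (h' : b ≤ c) :
    powSeq x (c - b) * powSeq x (b - a) = powSeq x (c - a) :=
  funext fun i => by
    have h1 : a i ≤ b i := h i
    have h2 : b i ≤ c i := h' i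
    simp only [powSeq, Pi.mul_apply, Pi.sub_apply, ← pow_add]
    congr 1
    omega

theorem powSeq_const_sub_mul_powSeq (x : Fin m → R) {a : Fin m → ℕ} {k : ℕ}
    (h : ∀ i, a i ≤ k) : powSeq x ((fun _ => k) - a) * powSeq x a = x ^ k :=
  powSeq_sub_mul_powSeq x (b := fun _ => k) h

theorem transition_cls (x : Fin m → R) {p : ℤ} {k l : ℕ} (h : k ≤ l) {z : Cochains m M}
    (hz : z ∈ cocycles M (x ^ k) p) :
    transition M x p k l h (cls M (x ^ k) p ⟨z, hz⟩) =
      cls M (x ^ l) p ⟨scale M (x ^ (l - k)) z, scale_mem_cocycles (pow_sub_mul_pow x h) hz⟩ :=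
  rfl

theorem ofPow_transition (x : Fin m → R) {p : ℤ} {k l : ℕ} (h : k ≤ l)
    (ξ : Cohomology M (x ^ k) p) : ofPow M x p l (transition M x p k l h ξ) = ofPow M x p k ξ :=
  Module.DirectLimit.of_f

theorem exists_ofPow (x : Fin m → R) {p : ℤ} (η : LocalCohomology M x p) :
    ∃ k ξ, ofPow M x p k ξ = η :=
  Module.DirectLimit.exists_of η

instance directedSystem_transition (x : Fin m → R) (p : ℤ) :
    DirectedSystem (fun k : ℕ => Cohomology M (x ^ k) p)
      (fun k l h => transition M x p k l h) where
  map_self k ξ := by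
    obtain ⟨⟨z, hz⟩, rfl⟩ := cls_surjective _ _ ξ
    rw [transition_cls]
    congr 2
    rw [Nat.sub_self, pow_zero, scale_one]
  map_map k j i h h' ξ := by
    obtain ⟨⟨z, hz⟩, rfl⟩ := cls_surjective _ _ ξ
    rw [transition_cls, transition_cls, transition_cls]
    congr 2
    rw [scale_scale, ← pow_add]
    congr 3
    omega

theorem exists_transition_eq_zero (x : Fin m → R) {p : ℤ} {k : ℕ} {ξ : Cohomology M (x ^ k) p}
    (h : ofPow M x p k ξ = 0) : ∃ l, ∃ hkl : k ≤ l, transition M x p k l hkl ξ = 0 :=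
  Module.DirectLimit.of.zero_exact h

/-- The class in local cohomology of a Koszul cocycle for the elements `x i ^ a i`. -/
def limitClass (x : Fin m → R) (a : Fin m → ℕ) (p : ℤ) :
    ↥(cocycles M (powSeq x a) p) →ₗ[R] LocalCohomology M x p :=
  ofPow M x p (Finset.univ.sup a) ∘ₗ
    cohomologyMap M (powSeq x ((fun _ => Finset.univ.sup a) - a))
      (powSeq_const_sub_mul_powSeq x fun i => Finset.le_sup (Finset.mem_univ i)) p ∘ₗ
    cls M (powSeq x a) p

theorem powSeq_const_sub (x : Fin m → R) {a : Fin m → ℕ} {k l : ℕ} (hk : ∀ i, a i ≤ k)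
    (hkl : k ≤ l) : x ^ (l - k) * powSeq x ((fun _ => k) - a) = powSeq x ((fun _ => l) - a) :=
  powSeq_sub_mul_powSeq_sub x (b := fun _ => k) (c := fun _ => l) hk fun _ => hkl

theorem limitClass_eq {x : Fin m → R} {a : Fin m → ℕ} {p : ℤ} {z : Cochains m M}
    (hz : z ∈ cocycles M (powSeq x a) p) {k : ℕ} (hk : ∀ i, a i ≤ k) :
    limitClass x a p ⟨z, hz⟩ = ofPow M x p k (cls M (x ^ k) p
      ⟨scale M (powSeq x ((fun _ => k) - a)) z,
        scale_mem_cocycles (powSeq_const_sub_mul_powSeq x hk) hz⟩) := by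
  have h0 : ∀ i, a i ≤ Finset.univ.sup a := fun i => Finset.le_sup (Finset.mem_univ i)
  have h : Finset.univ.sup a ≤ k := Finset.sup_le fun i _ => hk i
  rw [limitClass, LinearMap.comp_apply, LinearMap.comp_apply, cohomologyMap_cls,
    ← ofPow_transition x h, transition_cls]
  congr 3
  rw [scale_scale, powSeq_const_sub x h0 h]

theorem limitClass_scale {x : Fin m → R} {a b : Fin m → ℕ} (hab : a ≤ b) {p : ℤ}
    {z : Cochains m M} (hz : z ∈ cocycles M (powSeq x a) p) :
    limitClass x b p ⟨scale M (powSeq x (b - a)) z,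
      scale_mem_cocycles (powSeq_sub_mul_powSeq x hab) hz⟩ = limitClass x a p ⟨z, hz⟩ := by
  have h0 : ∀ i, b i ≤ Finset.univ.sup b := fun i => Finset.le_sup (Finset.mem_univ i)
  rw [limitClass_eq _ h0, limitClass_eq _ fun i => (hab i).trans (h0 i)]
  congr 3
  rw [scale_scale, powSeq_sub_mul_powSeq_sub x (c := fun _ => Finset.univ.sup b) hab h0]

theorem limitClass_eq_zero {x : Fin m → R} {a : Fin m → ℕ} {p : ℤ} {z : Cochains m M}
    (hz : z ∈ cocycles M (powSeq x a) p) (h : z ∈ coboundaries M (powSeq x a) p) :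
    limitClass x a p ⟨z, hz⟩ = 0 := by
  rw [limitClass, LinearMap.comp_apply, LinearMap.comp_apply, cls_eq_zero.2 h, map_zero, map_zero]

/-- A cocycle that vanishes in local cohomology becomes a coboundary for some equal exponents `l`,
which can be taken above any bound. -/
theorem exists_scale_mem_coboundaries {x : Fin m → R} {a : Fin m → ℕ} {p : ℤ} {z : Cochains m M}
    (hz : z ∈ cocycles M (powSeq x a) p) (h : limitClass x a p ⟨z, hz⟩ = 0) {k : ℕ}
    (hk : ∀ i, a i ≤ k) : ∃ l, k ≤ l ∧
      scale M (powSeq x ((fun _ => l) - a)) z ∈ coboundaries M (x ^ l) p := by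
  rw [limitClass_eq hz hk] at h
  obtain ⟨l, hkl, hl⟩ := exists_transition_eq_zero x h
  refine ⟨l, hkl, ?_⟩
  rw [transition_cls, cls_eq_zero] at hl
  change scale M _ (scale M _ z) ∈ _ at hl
  rwa [scale_scale, powSeq_const_sub x hk hkl] at hl

theorem exists_limitClass_eq {x : Fin m → R} {p : ℤ} (η : LocalCohomology M x p) :
    ∃ k, ∃ z : ↥(cocycles M (powSeq x fun _ => k) p), limitClass x (fun _ => k) p z = η := by
  obtain ⟨k, ξ, rfl⟩ := exists_ofPow x η
  obtain ⟨⟨z, hz⟩, rfl⟩ := cls_surjective _ _ ξ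
  refine ⟨k, ⟨z, hz⟩, ?_⟩
  rw [limitClass_eq (a := fun _ => k) hz fun _ => le_rfl]
  congr 3
  exact scale_powSeq_sub_self x (fun _ => k) z

/-- Classes of cocycles for the elements `x i` themselves come from Koszul cohomology. -/
theorem limitClass_one_mem_range_canonical {x : Fin m → R} {p : ℤ}
    (z : ↥(cocycles M (powSeq x fun _ => 1) p)) :
    limitClass x (fun _ => 1) p z ∈ LinearMap.range (canonical M x p) := by
  obtain ⟨z, hz⟩ := z
  have hz' : z ∈ cocycles M x p := by
    rwa [show (powSeq x fun _ => 1) = x from pow_one x] at hz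
  refine ⟨cls M x p ⟨z, hz'⟩, ?_⟩
  rw [limitClass_eq (a := fun _ => 1) hz fun _ => le_rfl, canonical, LinearMap.comp_apply,
    cohomologyMap_cls]
  congr 3
  rw [scale_one]
  exact (scale_powSeq_sub_self x (fun _ => 1) z).symm

section Grading

open FormRing

variable {A : Type*} [CommRing A] {q : Ideal A} {x : Fin m → FormRing q} {e : Fin m → ℕ}

theorem powSeq_mem_piece (hxe : ∀ i, x i ∈ FormRing.piece q (e i)) (a : Fin m → ℕ) (i : Fin m) :
    powSeq x a i ∈ FormRing.piece q ((a * e) i : ℕ) :=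
  pow_mem_piece (hxe i) (a i)

theorem scale_powSeq_mem_homogeneous (hxe : ∀ i, x i ∈ FormRing.piece q (e i))
    {a b : Fin m → ℕ} (hab : a ≤ b) {n : ℤ} {z : Cochains m (FormRing q)}
    (hz : z ∈ homogeneous q (a * e) n) :
    scale (FormRing q) (powSeq x (b - a)) z ∈ homogeneous q (b * e) n := by
  have := scale_mem_homogeneous (powSeq_mem_piece hxe (b - a)) hz
  convert this using 2
  ext i
  simp [Pi.mul_apply, Pi.sub_apply, ← add_mul, Nat.sub_add_cancel (hab i)]

theorem limitClass_mem_piece (hxe : ∀ i, x i ∈ FormRing.piece q (e i)) {a : Fin m → ℕ}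
    {p n : ℤ} {z : Cochains m (FormRing q)}
    (hz : z ∈ cocycles (FormRing q) (powSeq x a) p) (h : z ∈ homogeneous q (a * e) n) :
    limitClass x a p ⟨z, hz⟩ ∈ piece x e p n := by
  have h0 : ∀ i, a i ≤ Finset.univ.sup a := fun i => Finset.le_sup (Finset.mem_univ i)
  rw [limitClass_eq _ h0]
  refine AddSubgroup.mem_iSup_of_mem (Finset.univ.sup a) ⟨_, ?_, rfl⟩
  exact scale_powSeq_mem_homogeneous hxe (b := fun _ => Finset.univ.sup a) h0 h

end Grading

end LocalCohomology

/-! ### Koszul complexes with mixed exponents -/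

namespace LocalCohomology

open Koszul

section Mixed

variable {R : Type*} [CommRing R] {M : Type*} [AddCommGroup M] [Module R M] {m : ℕ}

/-- The exponents `1` on `S` and `k` off `S`. -/
def mixedExp (S : Finset (Fin m)) (k : ℕ) : Fin m → ℕ := fun i => if i ∈ S then 1 else k

theorem mixedExp_mono (S : Finset (Fin m)) {k l : ℕ} (h : k ≤ l) :
    mixedExp S k ≤ mixedExp S l := fun i => by
  unfold mixedExp
  split_ifs
  exacts [le_rfl, h]

theorem mixedExp_insert (S : Finset (Fin m)) (s : Fin m) (k : ℕ) :
    mixedExp (insert s S) k = Function.update (mixedExp S k) s 1 := by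
  ext i
  by_cases h : i = s
  · subst h; simp [mixedExp]
  · simp [mixedExp, h]

theorem mixedExp_of_notMem {S : Finset (Fin m)} {s : Fin m} (hs : s ∉ S) (k : ℕ) :
    mixedExp S k s = k :=
  if_neg hs

theorem mixedExp_insert_le (S : Finset (Fin m)) (s : Fin m) {k : ℕ} (hk : 1 ≤ k) :
    mixedExp (insert s S) k ≤ mixedExp S k := fun i => by
  rw [mixedExp_insert]
  by_cases h : i = s
  · subst h
    rw [Function.update_self]
    unfold mixedExp
    split_ifs
    exacts [le_rfl, hk]
  · rw [Function.update_of_ne h]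

theorem powSeq_update (x : Fin m → R) (a : Fin m → ℕ) (s : Fin m) (k : ℕ) :
    powSeq x (Function.update a s k) = Function.update (powSeq x a) s (x s ^ k) := by
  ext i
  by_cases h : i = s
  · subst h; simp [powSeq]
  · simp [powSeq, h]

theorem powSeq_update_sub_update (x : Fin m → R) (a : Fin m → ℕ) (s : Fin m) (k l : ℕ) :
    powSeq x (Function.update a s l - Function.update a s k) =
      Function.update (1 : Fin m → R) s (x s ^ (l - k)) := by
  ext i
  by_cases h : i = s
  · subst h; simp [powSeq]
  · simp [powSeq, h]

/-- If `x s` kills the class of the cocycle `z` already at the exponents `mixedExp S k`, then the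
exponent at `s` can be lowered to `1` without changing the class in local cohomology. -/
theorem limitClass_drop_add_wedge {x : Fin m → R} {S : Finset (Fin m)} {s : Fin m} (hs : s ∉ S)
    {k : ℕ} (hk : 1 ≤ k) {p : ℤ} {z w : Cochains m M}
    (hz : z ∈ cocycles M (powSeq x (mixedExp S k)) p) (hw : w ∈ degree R M m (p - 1))
    (hzw : x s • z = d M (powSeq x (mixedExp S k)) w) :
    ∃ h : drop R s z + wedge R s w ∈ cocycles M (powSeq x (mixedExp (insert s S) k)) p,
      limitClass x (mixedExp (insert s S) k) p ⟨_, h⟩ = limitClass x (mixedExp S k) p ⟨z, hz⟩ := by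
  have hbs : mixedExp S k s = k := mixedExp_of_notMem hs k
  rw [mixedExp_insert]
  generalize mixedExp S k = b at hz hzw hbs ⊢
  have hys : powSeq x b s = x s ^ k := by rw [powSeq, hbs]
  have hb0 : Function.update b s k = b := Function.update_eq_self_iff.2 hbs.symm
  have h : drop R s z + wedge R s w ∈ cocycles M (powSeq x (Function.update b s 1)) p := by
    refine ⟨add_mem (drop_mem_degree s hz.1) (wedge_mem_degree s hw), ?_⟩
    change d M _ _ = 0
    rw [powSeq_update, pow_one]
    exact d_drop_add_wedge hys (LinearMap.mem_ker.1 hz.2) hzw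
  refine ⟨h, ?_⟩
  have h1 : b ≤ Function.update b s (k + 1) := by
    conv_lhs => rw [← hb0]
    exact update_le_update_iff.2 ⟨Nat.le_succ k, fun _ _ => le_rfl⟩
  have h2 : Function.update b s 1 ≤ Function.update b s (k + 1) :=
    update_le_update_iff.2 ⟨by omega, fun _ _ => le_rfl⟩
  have e1 : powSeq x (Function.update b s (k + 1) - b) = Function.update (1 : Fin m → R) s (x s) := by
    conv_lhs => rw [← hb0, Function.update_idem, powSeq_update_sub_update]
    simp
  have e2 : powSeq x (Function.update b s (k + 1) - Function.update b s 1) =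
      Function.update (1 : Fin m → R) s (x s ^ k) := by
    rw [powSeq_update_sub_update, Nat.add_sub_cancel]
  rw [← limitClass_scale h1, ← limitClass_scale h2, eq_comm, ← sub_eq_zero, ← map_sub]
  refine limitClass_eq_zero _ ⟨wedge R s (contract R s w), ?_, ?_⟩
  · exact wedge_mem_degree s (contract_mem_degree s hw)
  · change _ = scale M (powSeq x _) z - scale M (powSeq x _) (drop R s z + wedge R s w)
    rw [e1, e2, scale_eq_scale_drop_add_wedge hys hzw, powSeq_update, pow_succ', add_sub_cancel_left]

/-- The elements `y i` annihilate the Koszul cohomology of `y`. -/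
theorem smul_mem_coboundaries {y : Fin m → R} {p : ℤ} {z : Cochains m M}
    (hz : z ∈ cocycles M y p) {r : R} {T : Set (Fin m)} (hr : r ∈ Ideal.span (y '' T)) :
    r • z ∈ coboundaries M y p := by
  induction hr using Submodule.span_induction with
  | mem r h =>
    obtain ⟨i, -, rfl⟩ := h
    refine ⟨contract R i z, contract_mem_degree i hz.1, ?_⟩
    rw [← d_contract y i z, LinearMap.mem_ker.1 hz.2, map_zero, add_zero]
  | zero => rw [zero_smul]; exact zero_mem _
  | add r r' _ _ h h' => rw [add_smul]; exact add_mem h h'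
  | smul a r _ h => rw [smul_eq_mul, mul_smul]; exact Submodule.smul_mem _ a h

theorem eq_zero_of_neg {x : Fin m → R} {p : ℤ} (hp : p < 0) (η : LocalCohomology M x p) :
    η = 0 := by
  obtain ⟨k, ⟨z, hz⟩, rfl⟩ := exists_limitClass_eq η
  obtain rfl : z = 0 := funext fun I => hz.1 I (by omega)
  exact map_zero _

end Mixed

/-! ### Lowering the exponents one at a time -/

open FormRing

variable {A : Type*} [CommRing A] {q : Ideal A} {m : ℕ} {x : Fin m → FormRing q} {e : Fin m → ℕ}

/-- Let `S` consist of indices of elements of degree one. A homogeneous cocycle of cohomological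
degree `p` and internal degree `n` for the exponents `mixedExp S k` that vanishes in local
cohomology becomes a coboundary as soon as the exponents off `S` are raised, provided that
`[H^{p - 1 - r}]_{n + 1 + r} = 0` for all `r ≥ 0`. -/
theorem exists_scale_mixedExp_mem_coboundaries (hxe : ∀ i, x i ∈ FormRing.piece q (e i))
    (S : Finset (Fin m)) (hS : ∀ s ∈ S, e s = 1) (p n : ℤ)
    (hpn : ∀ r : ℕ, piece x e (p - 1 - r) (n + 1 + r) = ⊥) {k : ℕ} (hk : 1 ≤ k)
    {z : Cochains m (FormRing q)}
    (hz : z ∈ cocycles (FormRing q) (powSeq x (mixedExp S k)) p)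
    (hzn : z ∈ homogeneous q (mixedExp S k * e) n)
    (hz0 : limitClass x (mixedExp S k) p ⟨z, hz⟩ = 0) :
    ∃ l, k ≤ l ∧ scale (FormRing q) (powSeq x (mixedExp S l - mixedExp S k)) z ∈
      coboundaries (FormRing q) (powSeq x (mixedExp S l)) p := by
  induction S using Finset.induction_on generalizing p n k z with
  | empty =>
    exact exists_scale_mem_coboundaries hz hz0 (k := k) fun i => by simp [mixedExp]
  | insert s S hs ih =>
    have ih := ih fun i hi => hS i (Finset.mem_insert_of_mem hi)
    have hes : e s = 1 := hS s (Finset.mem_insert_self s S)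
    -- Raising the exponent at `s` makes the induction hypothesis applicable.
    have hab := mixedExp_insert_le S s hk
    obtain ⟨l, hkl, hl⟩ := ih p n hpn hk
      (scale_mem_cocycles (powSeq_sub_mul_powSeq x hab) hz)
      (scale_powSeq_mem_homogeneous hxe hab hzn) ((limitClass_scale hab hz).trans hz0)
    have hl1 : 1 ≤ l := hk.trans hkl
    have haa := mixedExp_mono (insert s S) hkl
    have hab' := mixedExp_insert_le S s hl1
    have hz1 := scale_mem_cocycles (powSeq_sub_mul_powSeq x haa) hz
    have hz1n := scale_powSeq_mem_homogeneous hxe haa hzn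
    rw [scale_scale, powSeq_sub_mul_powSeq_sub x hab (mixedExp_mono S hkl),
      ← powSeq_sub_mul_powSeq_sub x haa hab', ← scale_scale] at hl
    suffices h : ∃ l', l ≤ l' ∧ scale (FormRing q)
        (powSeq x (mixedExp (insert s S) l' - mixedExp (insert s S) l))
        (scale (FormRing q) (powSeq x (mixedExp (insert s S) l - mixedExp (insert s S) k)) z) ∈
          coboundaries (FormRing q) (powSeq x (mixedExp (insert s S) l')) p by
      obtain ⟨l', hl', h⟩ := h
      rw [scale_scale, powSeq_sub_mul_powSeq_sub x haa (mixedExp_mono _ hl')] at h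
      exact ⟨l', hkl.trans hl', h⟩
    generalize scale (FormRing q) (powSeq x (mixedExp (insert s S) l - mixedExp (insert s S) k)) z
      = z1 at hl hz1 hz1n ⊢
    clear hz0 hzn hz hab haa z
    obtain ⟨w, hw, hwn, hzw⟩ := exists_homogeneous_eq_d (powSeq_mem_piece hxe _)
      (scale_powSeq_mem_homogeneous hxe hab' hz1n) hl
    -- The connecting homomorphism leads to a class in degrees `(p - 1, n + 1)`, which vanishes.
    set b := mixedExp S l with hb
    set a := mixedExp (insert s S) l with ha
    have hbs : b s = l := mixedExp_of_notMem hs l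
    have has : a s = 1 := by simp [ha, mixedExp]
    have hab : b = Function.update a s l := by
      rw [ha, mixedExp_insert, Function.update_idem]
      exact (Function.update_eq_self_iff.2 hbs.symm).symm
    have hys : powSeq x a s = x s := by rw [powSeq, has, pow_one]
    have hyb : powSeq x b = Function.update (powSeq x a) s (x s * x s ^ (l - 1)) := by
      rw [hab, powSeq_update, ← pow_succ', Nat.sub_add_cancel hl1]
    have hba : powSeq x (b - a) =
        Function.update (1 : Fin m → FormRing q) s (x s ^ (l - 1)) := by
      conv_lhs => rw [hab, ← Function.update_eq_self s a, Function.update_idem,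
        powSeq_update_sub_update, has]
    rw [hba, hyb] at hzw
    have ht : contract (FormRing q) s z1 - x s • w ∈ cocycles (FormRing q) (powSeq x b) (p - 1) := by
      refine ⟨sub_mem (contract_mem_degree s hz1.1) (Submodule.smul_mem _ _ hw), ?_⟩
      change d _ _ _ = 0
      rw [hyb]
      exact d_contract_sub hys (LinearMap.mem_ker.1 hz1.2) hzw
    have htn : contract (FormRing q) s z1 - x s • w ∈ homogeneous q (b * e) (n + 1) := by
      refine sub_mem ?_ ?_
      · have h := contract_mem_homogeneous (s := s) hz1n
        rw [Pi.mul_apply, has, hes, mul_one, Nat.cast_one] at h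
        rw [← drop_contract]
        refine drop_mem_homogeneous (fun i hi => ?_) h
        rw [hab, Pi.mul_apply, Pi.mul_apply, Function.update_of_ne hi]
      · have h := smul_mem_homogeneous (hxe s) hwn
        rwa [hes, Nat.cast_one] at h
    have ht0 : limitClass x b (p - 1) ⟨_, ht⟩ = 0 := by
      have h := limitClass_mem_piece hxe ht htn
      have h0 := hpn 0
      rw [Nat.cast_zero, sub_zero, add_zero] at h0
      rwa [h0, AddSubgroup.mem_bot] at h
    obtain ⟨l', hll', g, hg, hgt⟩ := ih (p - 1) (n + 1) (fun r => by
      have := hpn (r + 1)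
      rwa [Nat.cast_succ, add_comm (r : ℤ), ← add_assoc, ← sub_sub] at this) hl1 ht htn ht0
    refine ⟨l', hll', ?_⟩
    have hbb := mixedExp_mono S hll'
    have e1 : Function.update (powSeq x (mixedExp S l' - b)) s 1 =
        powSeq x (mixedExp (insert s S) l' - a) := by
      ext i
      by_cases h : i = s
      · subst h; simp [powSeq, ha, mixedExp]
      · simp [powSeq, ha, hb, mixedExp, h]
    rw [← powSeq_sub_mul_powSeq x hbb, ← hb, hyb] at hgt
    have h := scale_eq_d_of_contract_sub hys hzw hgt.symm
    rw [e1, powSeq_sub_mul_powSeq x (mixedExp_mono _ hll')] at h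
    rw [h]
    refine ⟨_, sub_mem (scale_mem_degree _ (drop_mem_degree s hw)) ?_, rfl⟩
    exact wedge_mem_degree s (drop_mem_degree s hg)

/-- Let `S` consist of indices of elements of degree one. A homogeneous class that is killed by
the `x i` comes from a homogeneous cocycle whose exponents on `S` are equal to `1`, provided that
`[H^{p - 1 - r}]_{n + 2 + r} = 0` for all `r ≥ 0`. -/
theorem exists_homogeneous_limitClass_mixedExp_eq (hxe : ∀ i, x i ∈ FormRing.piece q (e i))
    (S : Finset (Fin m)) (hS : ∀ s ∈ S, e s = 1) {p n : ℤ}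
    (hpn : ∀ r : ℕ, piece x e (p - 1 - r) (n + 2 + r) = ⊥) {η : LocalCohomology (FormRing q) x p}
    (hη : ∀ i, x i • η = 0) {k : ℕ} (hk : 1 ≤ k) {z : Cochains m (FormRing q)}
    (hz : z ∈ cocycles (FormRing q) (powSeq x fun _ => k) p)
    (hzn : z ∈ homogeneous q ((fun _ => k) * e) n) (hzη : limitClass x (fun _ => k) p ⟨z, hz⟩ = η) :
    ∃ l, 1 ≤ l ∧ ∃ z', ∃ hz' : z' ∈ cocycles (FormRing q) (powSeq x (mixedExp S l)) p,
      z' ∈ homogeneous q (mixedExp S l * e) n ∧ limitClass x (mixedExp S l) p ⟨z', hz'⟩ = η := by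
  induction S using Finset.induction_on with
  | empty =>
    have h : (mixedExp ∅ k : Fin m → ℕ) = fun _ => k := by ext; simp [mixedExp]
    exact ⟨k, hk, by rw [h]; exact ⟨z, hz, hzn, hzη⟩⟩
  | insert s S hs ih =>
    have hS' : ∀ i ∈ S, e i = 1 := fun i hi => hS i (Finset.mem_insert_of_mem hi)
    have hes : e s = 1 := hS s (Finset.mem_insert_self s S)
    clear hk hz hzn hzη z k
    obtain ⟨k, hk, z, hz, hzn, hzη⟩ := ih hS'
    have hxn := smul_mem_homogeneous (hxe s) hzn
    rw [hes, Nat.cast_one] at hxn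
    obtain ⟨l, hkl, hl⟩ := exists_scale_mixedExp_mem_coboundaries hxe S hS' p (n + 1)
      (fun r => by rw [add_assoc n]; exact hpn r) hk (Submodule.smul_mem _ (x s) hz) hxn
      (by rw [← hη s, ← hzη]; exact (limitClass x (mixedExp S k) p).map_smul (x s) ⟨z, hz⟩)
    have hbb := mixedExp_mono S hkl
    obtain ⟨w, hw, hwn, hzw⟩ := exists_homogeneous_eq_d (powSeq_mem_piece hxe _)
      (scale_powSeq_mem_homogeneous hxe hbb hxn) hl
    rw [map_smul] at hzw
    obtain ⟨h, hlim⟩ := limitClass_drop_add_wedge hs (hk.trans hkl)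
      (scale_mem_cocycles (powSeq_sub_mul_powSeq x hbb) hz) hw hzw
    have hne : ∀ i, i ≠ s → (mixedExp S l * e) i = (mixedExp (insert s S) l * e) i :=
      fun i hi => by
        rw [mixedExp_insert, Pi.mul_apply, Pi.mul_apply, Function.update_of_ne hi]
    refine ⟨l, hk.trans hkl, _, h, add_mem ?_ ?_, hlim.trans ((limitClass_scale hbb hz).trans hzη)⟩
    · exact drop_mem_homogeneous hne (scale_powSeq_mem_homogeneous hxe hbb hzn)
    · rw [← wedge_drop]
      apply wedge_mem_homogeneous
      rw [mixedExp_insert, Pi.mul_apply, Function.update_self, hes, mul_one, Nat.cast_one,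
        ← mixedExp_insert]
      exact drop_mem_homogeneous hne hwn

/-- Once the exponents of enough elements to generate the ideal have been lowered to `1`, the
other exponents can be lowered as well: the remaining elements act as zero. -/
theorem mem_range_canonical_of_limitClass_mixedExp {R : Type*} [CommRing R] {M : Type*}
    [AddCommGroup M] [Module R M] {x : Fin m → R} {S : Finset (Fin m)}
    (hS : ∀ i, x i ∈ Ideal.span (x '' S)) {k : ℕ} (hk : 1 ≤ k) {p : ℤ} {z : Cochains m M}
    (hz : z ∈ cocycles M (powSeq x (mixedExp S k)) p) :
    limitClass x (mixedExp S k) p ⟨z, hz⟩ ∈ LinearMap.range (canonical M x p) := by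
  have key : ∀ T : Finset (Fin m), ∃ z',
      ∃ hz' : z' ∈ cocycles M (powSeq x (mixedExp (T ∪ S) k)) p,
        limitClass x (mixedExp (T ∪ S) k) p ⟨z', hz'⟩ = limitClass x (mixedExp S k) p ⟨z, hz⟩ := by
    intro T
    induction T using Finset.induction_on with
    | empty => exact ⟨z, by rw [Finset.empty_union]; exact ⟨hz, rfl⟩⟩
    | insert s T _ ih =>
      rw [Finset.insert_union]
      by_cases hs : s ∈ T ∪ S
      · rwa [Finset.insert_eq_of_mem hs]
      obtain ⟨z', hz', h⟩ := ih
      have hx : x s ∈ Ideal.span (powSeq x (mixedExp (T ∪ S) k) '' S) := by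
        convert hS s using 2
        refine Set.image_congr fun i hi => ?_
        rw [powSeq, mixedExp, if_pos (Finset.mem_union_right T hi), pow_one]
      obtain ⟨w, hw, hzw⟩ := smul_mem_coboundaries hz' hx
      obtain ⟨h1, h2⟩ := limitClass_drop_add_wedge hs hk hz' hw hzw.symm
      exact ⟨_, h1, h2.trans h⟩
  obtain ⟨z', hz', h⟩ := key Finset.univ
  rw [← h]
  have h1 : mixedExp (Finset.univ ∪ S) k = fun _ => 1 := by ext; simp [mixedExp]
  clear h
  revert hz'
  rw [h1]
  exact fun hz' => limitClass_one_mem_range_canonical ⟨z', hz'⟩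

end LocalCohomology

end

theorem theorem1p3 {A : Type*} [CommRing A] [IsNoetherianRing A] (q : Ideal A)
    -- a finite system of homogeneous generators of `Q`, computing Koszul and local cohomology
    {m : ℕ} (x : Fin m → FormRing q) (e : Fin m → ℕ)
    (hxe : ∀ i, x i ∈ FormRing.piece q (e i))
    (hx : Ideal.span (Set.range x) = FormRing.initialIdeal q)
    (t : ℤ)
    (hdeg : ∀ i j : ℤ, 0 ≤ i → i < j → j < t → ∀ p r : ℤ,
      LocalCohomology.piece x e i (p - i) ≠ ⊥ →
      LocalCohomology.piece x e j (r - j) ≠ ⊥ → p - r ≠ 1)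
    (hQ : ∀ i : ℤ, i < t →
      FormRing.initialIdeal q •
        (⊤ : Submodule (FormRing q) (LocalCohomology (FormRing q) x i)) = ⊥) :
    ∀ i : ℤ, i < t → Function.Surjective (LocalCohomology.canonical (FormRing q) x i) := by
  intro i hi
  rw [← LinearMap.range_eq_top, eq_top_iff]
  rintro η -
  have hxi : ∀ j, x j ∈ FormRing.initialIdeal q := fun j => hx ▸ Ideal.subset_span ⟨j, rfl⟩
  have hxη : ∀ j (ζ : LocalCohomology (FormRing q) x i), x j • ζ = 0 := fun j ζ => by
    have h := Submodule.smul_mem_smul (hxi j)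
      (Submodule.mem_top : ζ ∈ (⊤ : Submodule (FormRing q) (LocalCohomology (FormRing q) x i)))
    rwa [hQ i hi, Submodule.mem_bot] at h
  obtain ⟨k, ⟨z, hz⟩, rfl⟩ := LocalCohomology.exists_limitClass_eq η
  -- Split the class into homogeneous components, after raising the exponent to be positive.
  have hkk : (fun _ : Fin m => k) ≤ fun _ => k + 1 := fun _ => Nat.le_succ k
  rw [← LocalCohomology.limitClass_scale hkk hz]
  suffices h : ∀ y, LocalCohomology.limitClass x (fun _ => k + 1) i y ∈
      LinearMap.range (LocalCohomology.canonical (FormRing q) x i) from h _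
  rintro ⟨z', hz'⟩
  set b : Fin m → ℕ := fun _ => k + 1
  have hcomp : ∀ n, Koszul.component q (b * e) n z' ∈
      Koszul.cocycles (FormRing q) (LocalCohomology.powSeq x b) i := fun n => by
    refine ⟨Koszul.component_mem_degree _ _ hz'.1, ?_⟩
    change Koszul.d (FormRing q) (LocalCohomology.powSeq x b) _ = 0
    rw [← Koszul.component_d (LocalCohomology.powSeq_mem_piece hxe b), LinearMap.mem_ker.1 hz'.2,
      map_zero]
  obtain ⟨F, hF⟩ := Koszul.exists_sum_component (b * e) z'
  have hsum : (⟨z', hz'⟩ : ↥(Koszul.cocycles (FormRing q) (LocalCohomology.powSeq x b) i)) =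
      ∑ n ∈ F, ⟨_, hcomp n⟩ := by
    ext1
    rw [AddSubmonoidClass.coe_finsetSum]
    exact hF.symm
  rw [hsum, map_sum]
  refine sum_mem fun n _ => ?_
  have hn := Koszul.component_mem (b * e) n z'
  generalize hη : LocalCohomology.limitClass x b i ⟨_, hcomp n⟩ = η
  by_cases h0 : η = 0
  · rw [h0]; exact zero_mem _
  have hpiece : LocalCohomology.piece x e i n ≠ ⊥ := fun h => h0 (by
    have := LocalCohomology.limitClass_mem_piece hxe (hcomp n) hn
    rwa [h, AddSubgroup.mem_bot, hη] at this)
  have hvan : ∀ r : ℕ, LocalCohomology.piece x e (i - 1 - r) (n + 2 + r) = ⊥ := fun r => by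
    by_cases hr : 0 ≤ i - 1 - r
    · by_contra hne
      refine hdeg (i - 1 - r) i hr (by omega) hi (n + i + 1) (n + i) ?_ ?_ (by ring)
      · rwa [show n + i + 1 - (i - 1 - r) = n + 2 + r by ring]
      · rwa [add_sub_cancel_right]
    · exact (AddSubgroup.eq_bot_iff_forall _).2 fun ζ _ =>
        LocalCohomology.eq_zero_of_neg (by omega) ζ
  obtain ⟨l, hl, w, hw, -, hwη⟩ := LocalCohomology.exists_homogeneous_limitClass_mixedExp_eq hxe
    (Finset.univ.filter fun s => e s = 1) (fun s hs => (Finset.mem_filter.1 hs).2) hvan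
    (fun j => hxη j η) (Nat.le_add_left 1 k) (hcomp n) hn hη
  rw [← hwη]
  refine LocalCohomology.mem_range_canonical_of_limitClass_mixedExp (fun j => ?_) hl hw
  have := FormRing.initialIdeal_le_span_degree_one hxe hx (hxi j)
  simpa using this
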